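/- For $t\in\{\pi/2,\ \pi/3,\ \pi/4,\ 2\pi/3\}$ the integral $$I(t)=\int_0^\infty \frac{\log x\,\sinh x\,\sinh 2x}{(\cos t+\cosh 2x)^2}\,dx$$ converges absolutely, and its values are given in closed form as follows. 1. ($t=\pi/2$) The integrand of $I(\pi/2)$ equals $\log (x)\sinh (x)\tanh (2x)\,\mathrm{sech}(2x)$, and $$\int_0^\infty \log (x)\,\sinh (x)\,\tanh (2x)\,\mathrm{sech}(2x)\,dx=\frac18\left(4\sinh^{-1}(1)+\sqrt2\,\pi\log\frac{2\pi\,\Gamma(5/8)\,\Gamma(7/8)}{\Gamma(1/8)\,\Gamma(3/8)}\right).$$ 2. ($t=\pi/3$) The integrand of $I(\pi/3)$ is $4$ times the following one, and $$\int_0^\infty \frac{\log (x)\sinh (x)\sinh (2x)}{(2\cosh (2x)+1)^2}\,dx=\frac1{288}\left(10\sqrt3\,\pi\log 2+6\log 64+9\sqrt3\,\pi\log\pi+6\sqrt3\,\pi\log\frac{\Gamma(5/6)}{\Gamma(1/6)^2}\right).$$ 3. ($t=\pi/4$) $$\int_0^\infty \frac{\log (x)\sinh (x)\sinh (2x)}{(\cos(\pi/4)+\cosh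 (2x))^2}\,dx=\frac12\left((1+\sqrt2)\log\tan\frac{3\pi}{16}-\log\tan\frac{\pi}{16}\right)+\frac{\pi}{8\cos(\pi/8)}\log\frac{2\pi\,\Gamma(11/16)\,\Gamma(13/16)}{\Gamma(3/16)\,\Gamma(5/16)}.$$ 4. ($t=2\pi/3$) The integrand of $I(2\pi/3)$ is $4$ times the following one, and $$\int_0^\infty \frac{\log (x)\sinh (x)\sinh (2x)}{(2\cosh (2x)-1)^2}\,dx=\frac1{16}\left(4\coth^{-1}(\sqrt3)+\pi\log\frac{2\pi\,\Gamma(7/12)\,\Gamma(11/12)}{\Gamma(1/12)\,\Gamma(5/12)}\right).$$ -/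

import Mathlib

/-- The inverse hyperbolic cotangent; for `1 < |x|` it is the unique `y` with `coth y = x`. -/
noncomputable def arcoth (x : ℝ) : ℝ := Real.artanh x⁻¹

/-- The integrand `log x · sinh x · sinh 2x / (cos t + cosh 2x)²`. -/
noncomputable def logSinhIntegrand (t x : ℝ) : ℝ :=
  Real.log x * Real.sinh x * Real.sinh (2 * x) / (Real.cos t + Real.cosh (2 * x)) ^ 2

open Real Set Filter MeasureTheory Topology Asymptotics

/-! Put c = cos t. The derivative of sinh x / (c + cosh 2x) is cosh x / (c + cosh 2x) minus twice
the factor of log x in the integrand. Integrating by parts against log x gives I(t) = (J + K) / 2,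
where J = ∫ log x · cosh x / (c + cosh 2x) dx and K = ∫ x⁻¹ · sinh x / (c + cosh 2x) dx
(`integral_log_mul_sinh_mul_sinh_div`).

J splits by partial fractions into two Malmsten integrals ∫ log x / (cosh x - cos θ) dx. Each is the
derivative at s = 1 of a Mellin transform equal to Γ(s) ∑ sin(nθ) n⁻ˢ. The functional equation moves
this to the odd Hurwitz zeta function at 0, where a Lerch-type formula yields log Γ
(`hasDerivAt_hurwitzZetaOdd_zero`, `integral_log_malmsten`).

For K, when t is one of the given rational multiples of π, the fraction in q = exp (-x) has a
denominator dividing some 1 - q ^ P. Expanding geometrically, integrating each term by Frullani and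
summing by Euler's limit for Γ gives a finite combination of values log Γ(r / P)
(`integral_inv_mul_expQuot`). Reflection turns this combination into logarithms of sines. The
Lerch-type formula also comes from `integral_inv_mul_expQuot`. -/

/-! ### Convergence and Frullani integrals for the measure dx / x. -/

lemma integrableOn_inv_mul_of_isBigO {f : ℝ → ℝ} (hf : ContinuousOn f (Ioi 0))
    (htop : f =O[atTop] fun x : ℝ ↦ x ^ (-1 : ℝ)) (hbot : f =O[𝓝[>] 0] fun x : ℝ ↦ x) :
    IntegrableOn (fun x ↦ x⁻¹ * f x) (Ioi 0) := by
  -- Integrating against dx / x is the Mellin transform at s = 0, interior to the strip -1 < Re s <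
  -- 1.
  have h := mellin_convergent_of_isBigO_scalar (a := 1) (b := -1) (s := 0)
    (hf.locallyIntegrableOn measurableSet_Ioi) htop one_pos (by simpa using hbot) (by norm_num)
  simpa [rpow_neg_one] using h

lemma isBigO_exp_neg_mul_atTop {a : ℝ} (ha : 0 < a) (r : ℝ) :
    (fun x : ℝ ↦ exp (-(a * x))) =O[atTop] fun x : ℝ ↦ x ^ r := by
  simpa using (isLittleO_exp_neg_mul_rpow_atTop ha r).isBigO

lemma integrableOn_inv_mul_exp_sub {a b : ℝ} (ha : 0 < a) (hb : 0 < b) :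
    IntegrableOn (fun x ↦ x⁻¹ * (exp (-(a * x)) - exp (-(b * x)))) (Ioi 0) := by
  refine integrableOn_inv_mul_of_isBigO (by fun_prop)
    ((isBigO_exp_neg_mul_atTop ha _).sub (isBigO_exp_neg_mul_atTop hb _)) ?_
  have h : DifferentiableAt ℝ (fun x : ℝ ↦ exp (-(a * x)) - exp (-(b * x))) 0 := by fun_prop
  simpa using h.isBigO_sub.mono nhdsWithin_le_nhds

lemma integral_inv_mul_exp_sub {a b : ℝ} (ha : 0 < a) (hb : 0 < b) :
    ∫ x in Ioi (0 : ℝ), x⁻¹ * (exp (-(a * x)) - exp (-(b * x))) = log b - log a := by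
  have hc : Continuous fun x : ℝ ↦ exp (-x) := by fun_prop
  have h := Frullani.integral_Ioi_eq (f := fun x ↦ exp (-x)) (L := 1) (R := 0)
    (hc.locallyIntegrable.locallyIntegrableOn _) ha hb
    (by simpa using (hc.tendsto 0).mono_left nhdsWithin_le_nhds)
    (tendsto_exp_atBot.comp tendsto_neg_atTop_atBot)
    (by simpa using integrableOn_inv_mul_exp_sub ha hb)
  simpa [log_div hb.ne' ha.ne'] using h

/-! ### Exponential quotients integrated against dx / x, and log Γ. -/

section ExpQuot

variable {ι : Type*} [Fintype ι]

/-- The quotient `∑ i, c i * exp (-α i x) / (1 - exp (-x))`. -/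
noncomputable def expQuot (c α : ι → ℝ) (x : ℝ) : ℝ :=
  (∑ i, c i * exp (-(α i * x))) / (1 - exp (-x))

lemma one_sub_exp_neg_pos {x : ℝ} (hx : 0 < x) : 0 < 1 - exp (-x) := by
  simpa using hx

lemma continuousOn_expQuot (c α : ι → ℝ) : ContinuousOn (expQuot c α) (Ioi 0) :=
  ContinuousOn.div (by fun_prop) (by fun_prop) fun _ hx ↦ (one_sub_exp_neg_pos hx).ne'

lemma isBigO_expQuot_atTop (c : ι → ℝ) {α : ι → ℝ} (hα : ∀ i, 0 < α i) (r : ℝ) :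
    expQuot c α =O[atTop] fun x : ℝ ↦ x ^ r := by
  have h1 : (fun x : ℝ ↦ ∑ i, c i * exp (-(α i * x))) =O[atTop] fun x : ℝ ↦ x ^ r :=
    IsBigO.fun_sum fun i _ ↦ (isBigO_exp_neg_mul_atTop (hα i) r).const_mul_left _
  have h2 : Tendsto (fun x : ℝ ↦ (1 - exp (-x))⁻¹) atTop (𝓝 1) := by
    simpa using ((tendsto_exp_atBot.comp tendsto_neg_atTop_atBot).const_sub (1 : ℝ)).inv₀
      (by norm_num)
  exact (h1.mul (h2.isBigO_one ℝ)).congr (fun x ↦ by rw [expQuot, div_eq_mul_inv]) (by simp)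

lemma isBigO_inv_one_sub_exp_neg :
    (fun x : ℝ ↦ (1 - exp (-x))⁻¹) =O[𝓝[>] 0] fun x ↦ x⁻¹ := by
  refine IsBigO.of_bound 2 ?_
  filter_upwards [Ioo_mem_nhdsGT (zero_lt_one' ℝ)] with x hx
  have hpos := one_sub_exp_neg_pos hx.1
  rw [norm_of_nonneg (inv_nonneg.2 hpos.le), norm_of_nonneg (inv_nonneg.2 hx.1.le),
    ← div_eq_mul_inv, inv_le_comm₀ hpos (by have := hx.1; positivity), inv_div]
  -- This gives 1 - exp (-x) ≥ x / (1 + x) ≥ x / 2 on (0, 1), whence the constant 2.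
  have h2 : exp (-x) * (1 + x) ≤ 1 := by
    calc exp (-x) * (1 + x) ≤ exp (-x) * exp x := by gcongr; linarith [add_one_le_exp x]
      _ = 1 := by rw [← exp_add]; simp
  nlinarith [hx.1, hx.2, exp_pos (-x)]

/-- The two moment conditions cancel the Taylor terms of order 0 and 1 of the numerator, and the
denominator costs one power of x. -/
lemma isBigO_expQuot_zero {c α : ι → ℝ} (h0 : ∑ i, c i = 0) (h1 : ∑ i, c i * α i = 0) :
    expQuot c α =O[𝓝[>] 0] fun x : ℝ ↦ x := by
  have hexp (a : ℝ) : (fun x : ℝ ↦ exp (-(a * x)) - 1 - -(a * x)) =O[𝓝[>] 0] fun x ↦ x ^ 2 := by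
    have ht : Tendsto (fun x : ℝ ↦ |-(a * x)|) (𝓝[>] 0) (𝓝 0) := by
      have : Continuous fun x : ℝ ↦ |-(a * x)| := by fun_prop
      simpa using (this.tendsto 0).mono_left nhdsWithin_le_nhds
    refine IsBigO.of_bound (a ^ 2) ?_
    filter_upwards [ht.eventually_le_const one_pos] with x hx
    have := abs_exp_sub_one_sub_id_le hx
    rw [norm_eq_abs, norm_eq_abs, abs_of_nonneg (sq_nonneg x)]
    linarith [mul_pow a x 2, neg_sq (a * x)]
  have hp : (fun x : ℝ ↦ ∑ i, c i * exp (-(α i * x))) =O[𝓝[>] 0] fun x ↦ x ^ 2 := by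
    have h : (fun x : ℝ ↦ ∑ i, c i * (exp (-(α i * x)) - 1 - -(α i * x))) =O[𝓝[>] 0]
        fun x ↦ x ^ 2 := IsBigO.fun_sum fun i _ ↦ (hexp (α i)).const_mul_left _
    refine h.congr_left fun x ↦ ?_
    have : ∑ i, c i * (exp (-(α i * x)) - 1 - -(α i * x)) =
        ∑ i, c i * exp (-(α i * x)) - ∑ i, c i + (∑ i, c i * α i) * x := by
      rw [Finset.sum_mul, ← Finset.sum_sub_distrib, ← Finset.sum_add_distrib]
      exact Finset.sum_congr rfl fun i _ ↦ by ring
    rw [this, h0, h1]; ring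
  refine (hp.mul isBigO_inv_one_sub_exp_neg).congr' (.of_forall fun x ↦ rfl) ?_
  filter_upwards [self_mem_nhdsWithin] with x (hx : 0 < x)
  field_simp

lemma integrableOn_inv_mul_expQuot {c α : ι → ℝ} (hα : ∀ i, 0 < α i) (h0 : ∑ i, c i = 0)
    (h1 : ∑ i, c i * α i = 0) : IntegrableOn (fun x ↦ x⁻¹ * expQuot c α x) (Ioi 0) :=
  integrableOn_inv_mul_of_isBigO (continuousOn_expQuot c α) (isBigO_expQuot_atTop c hα _)
    (isBigO_expQuot_zero h0 h1)

/-- Since the coefficients sum to zero, exp (-x) may be subtracted from every exponential, leaving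
Frullani integrals. -/
lemma integral_inv_mul_sum_exp {c α : ι → ℝ} (hα : ∀ i, 0 < α i) (h0 : ∑ i, c i = 0) :
    ∫ x in Ioi (0 : ℝ), x⁻¹ * ∑ i, c i * exp (-(α i * x)) = -∑ i, c i * log (α i) := by
  have h (x : ℝ) : x⁻¹ * ∑ i, c i * exp (-(α i * x)) =
      ∑ i, c i * (x⁻¹ * (exp (-(α i * x)) - exp (-(1 * x)))) := by
    have : ∑ i, c i * (x⁻¹ * (exp (-(α i * x)) - exp (-(1 * x)))) =
        x⁻¹ * ∑ i, c i * exp (-(α i * x)) - (∑ i, c i) * (x⁻¹ * exp (-(1 * x))) := by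
      rw [Finset.mul_sum, Finset.sum_mul, ← Finset.sum_sub_distrib]
      exact Finset.sum_congr rfl fun i _ ↦ by ring
    rw [this, h0]; ring
  simp_rw [h]
  rw [integral_finsetSum _ fun i _ ↦ (integrableOn_inv_mul_exp_sub (hα i) one_pos).const_mul _]
  simp_rw [integral_const_mul, integral_inv_mul_exp_sub (hα _) one_pos]
  simp

/-- Expanding 1 / (1 - exp (-x)) gives the series of -∑ c i log (α i + m) over m. Its partial sums
are those of Euler's limit for log Γ, whose terms α i log N and log N! drop out by the moment
conditions. -/
lemma integral_inv_mul_expQuot {c α : ι → ℝ} (hα : ∀ i, 0 < α i) (h0 : ∑ i, c i = 0)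
    (h1 : ∑ i, c i * α i = 0) :
    ∫ x in Ioi (0 : ℝ), x⁻¹ * expQuot c α x = ∑ i, c i * log (Gamma (α i)) := by
  set p : ℝ → ℝ := fun x ↦ ∑ i, c i * exp (-(α i * x)) with hp
  have hgeom {x : ℝ} (hx : x ∈ Ioi 0) :
      HasSum (fun m : ℕ ↦ exp (-x) ^ m) (1 - exp (-x))⁻¹ :=
    hasSum_geometric_of_lt_one (exp_pos _).le (by simpa using hx)
  have hsum : HasSum (fun m : ℕ ↦ ∫ x in Ioi (0 : ℝ), x⁻¹ * p x * exp (-x) ^ m)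
      (∫ x in Ioi (0 : ℝ), x⁻¹ * expQuot c α x) := by
    refine hasSum_integral_of_dominated_convergence (fun m x ↦ |x⁻¹ * p x| * exp (-x) ^ m)
      (fun m ↦ ?_) (fun m ↦ .of_forall fun x ↦ ?_) ?_ ?_ ?_
    · refine ContinuousOn.aestronglyMeasurable ?_ measurableSet_Ioi
      exact ((continuousOn_inv₀.mono fun x hx ↦ ne_of_gt hx).mul (by fun_prop)).mul (by fun_prop)
    · simp [abs_mul]
    · filter_upwards [ae_restrict_mem measurableSet_Ioi] with x hx
      exact (hgeom hx).summable.mul_left _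
    · refine (integrableOn_inv_mul_expQuot hα h0 h1).abs.congr ?_
      filter_upwards [ae_restrict_mem measurableSet_Ioi] with x hx
      rw [((hgeom hx).mul_left _).tsum_eq, expQuot, abs_mul, abs_mul, abs_div,
        abs_of_pos (one_sub_exp_neg_pos hx), div_eq_mul_inv, mul_assoc]
    · filter_upwards [ae_restrict_mem measurableSet_Ioi] with x hx
      rw [expQuot, div_eq_mul_inv, ← mul_assoc]
      exact (hgeom hx).mul_left _
  have hterm (m : ℕ) : ∫ x in Ioi (0 : ℝ), x⁻¹ * p x * exp (-x) ^ m =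
      -∑ i, c i * log (α i + m) := by
    rw [← integral_inv_mul_sum_exp (fun i ↦ add_pos_of_pos_of_nonneg (hα i) m.cast_nonneg) h0]
    refine integral_congr_ae (.of_forall fun x ↦ ?_)
    simp only [hp, mul_assoc, Finset.sum_mul, ← exp_nat_mul, ← exp_add]
    congr 1
    exact Finset.sum_congr rfl fun i _ ↦ by ring_nf
  simp_rw [hterm] at hsum
  -- The shift by 1 matches `logGammaSeq`, whose N-th term sums over m ≤ N.
  refine tendsto_nhds_unique (hsum.tendsto_sum_nat.comp (tendsto_add_atTop_nat 1)) ?_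
  have hlim := tendsto_finsetSum Finset.univ fun i _ ↦
    (BohrMollerup.tendsto_log_gamma (hα i)).const_mul (c i)
  refine hlim.congr fun N ↦ ?_
  simp only [BohrMollerup.logGammaSeq, Function.comp_apply, Finset.sum_neg_distrib]
  rw [Finset.sum_comm]
  simp_rw [← Finset.mul_sum]
  have : ∑ i, c i * (α i * log N + log N.factorial - ∑ m ∈ Finset.range (N + 1), log (α i + m)) =
      (∑ i, c i * α i) * log N + (∑ i, c i) * log N.factorial -
        ∑ i, c i * ∑ m ∈ Finset.range (N + 1), log (α i + m) := by
    simp only [Finset.sum_mul, ← Finset.sum_add_distrib, ← Finset.sum_sub_distrib]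
    exact Finset.sum_congr rfl fun i _ ↦ by ring
  rw [this, h0, h1]; ring

end ExpQuot

/-! ### The odd Hurwitz zeta function near s = 0. -/

lemma mellinConvergent_exp_div {α : ℝ} (hα : 0 < α) {s : ℂ} (hs : 1 < s.re) :
    MellinConvergent (fun x : ℝ ↦ ((exp (-(α * x)) / (1 - exp (-x)) : ℝ) : ℂ)) s := by
  have hc : ContinuousOn (fun x : ℝ ↦ exp (-(α * x)) / (1 - exp (-x))) (Ioi 0) :=
    ContinuousOn.div (by fun_prop) (by fun_prop) fun _ hx ↦ (one_sub_exp_neg_pos hx).ne'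
  refine mellinConvergent_of_isBigO_rpow (a := s.re + 1) (b := 1)
    ((Complex.continuous_ofReal.comp_continuousOn hc).locallyIntegrableOn measurableSet_Ioi)
    ?_ (by linarith) ?_ hs
  · rw [← isBigO_norm_left]
    simp only [Complex.norm_real, isBigO_norm_left]
    exact (isBigO_expQuot_atTop (fun _ : Unit ↦ 1) (fun _ ↦ hα) (-(s.re + 1))).congr_left
      fun x ↦ by simp [expQuot]
  · rw [← isBigO_norm_left]
    simp only [Complex.norm_real, isBigO_norm_left, div_eq_mul_inv, rpow_neg_one]
    have : Continuous fun x : ℝ ↦ exp (-(α * x)) := by fun_prop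
    simpa using (((this.tendsto 0).mono_left nhdsWithin_le_nhds).isBigO_one ℝ).mul
      isBigO_inv_one_sub_exp_neg

lemma hasSum_mellin_exp_div {α : ℝ} (hα : 0 < α) {s : ℂ} (hs : 1 < s.re) :
    HasSum (fun n : ℕ ↦ Complex.Gamma s * (1 / (n + α : ℂ) ^ s))
      (mellin (fun x : ℝ ↦ ((exp (-(α * x)) / (1 - exp (-x)) : ℝ) : ℂ)) s) := by
  have h := hasSum_mellin (a := fun _ : ℕ ↦ 1) (p := fun n ↦ n + α)
    (F := fun x : ℝ ↦ ((exp (-(α * x)) / (1 - exp (-x)) : ℝ) : ℂ)) (s := s)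
    (fun n ↦ .inr (by positivity)) (by linarith) (fun t ht ↦ ?_) ?_
  · simpa [div_eq_mul_inv] using h
  · have hg : HasSum (fun m : ℕ ↦ exp (-t) ^ m) (1 - exp (-t))⁻¹ :=
      hasSum_geometric_of_lt_one (exp_pos _).le (by simpa using ht)
    have := Complex.hasSum_ofReal.2 (hg.mul_left (exp (-(α * t))))
    rw [← div_eq_mul_inv] at this
    refine this.congr_fun fun n ↦ ?_
    rw [one_mul, ← exp_nat_mul, ← exp_add]
    congr 2; ring
  · have := (Real.summable_one_div_nat_add_rpow α s.re).2 hs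
    refine this.congr fun n ↦ ?_
    rw [abs_of_pos (by positivity)]; simp

section HurwitzOdd

variable {a : ℝ}

/-- The quotient `(exp (-a x) - exp (-(1 - a) x)) / (1 - exp (-x)) - (1 - 2 a) exp (-x)`, which
vanishes at `0`. -/
noncomputable def oddQuot (a : ℝ) : ℝ → ℝ :=
  -- The correction is written as (1 - 2a)(q - q²) / (1 - q) with q = exp (-x). The added exponents
  -- 1 and 2 restore the moment conditions and contribute log Γ(1) = log Γ(2) = 0.
  expQuot ![1, -1, -(1 - 2 * a), 1 - 2 * a] ![a, 1 - a, 1, 2]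

lemma oddQuot_eq (a : ℝ) {x : ℝ} (hx : 0 < x) : oddQuot a x =
    exp (-(a * x)) / (1 - exp (-x)) - exp (-((1 - a) * x)) / (1 - exp (-x)) -
      (1 - 2 * a) * exp (-x) := by
  have h := (one_sub_exp_neg_pos hx).ne'
  have h2 : exp (-(2 * x)) = exp (-x) * exp (-x) := by rw [← exp_add]; ring_nf
  simp only [oddQuot, expQuot, Fin.sum_univ_four, Matrix.cons_val, h2]
  field_simp
  ring

lemma oddQuot_exponent_pos (ha : a ∈ Ioo 0 1) (i : Fin 4) :
    0 < (![a, 1 - a, 1, 2] : Fin 4 → ℝ) i := by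
  fin_cases i <;> simp [ha.1, ha.2]

lemma oddQuot_sum_coeff (a : ℝ) :
    ∑ i, (![1, -1, -(1 - 2 * a), 1 - 2 * a] : Fin 4 → ℝ) i = 0 := by
  simp [Fin.sum_univ_four]

lemma oddQuot_sum_coeff_mul (a : ℝ) :
    ∑ i, (![1, -1, -(1 - 2 * a), 1 - 2 * a] : Fin 4 → ℝ) i *
      (![a, 1 - a, 1, 2] : Fin 4 → ℝ) i = 0 := by
  simp [Fin.sum_univ_four]; ring

lemma differentiableAt_mellin_oddQuot (ha : a ∈ Ioo 0 1) {s : ℂ} (hs : -1 < s.re) :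
    DifferentiableAt ℂ (mellin fun x ↦ (oddQuot a x : ℂ)) s := by
  refine mellin_differentiableAt_of_isBigO_rpow (a := s.re + 1) (b := -1)
    ((Complex.continuous_ofReal.comp_continuousOn
      (continuousOn_expQuot _ _)).locallyIntegrableOn measurableSet_Ioi) ?_ (by linarith) ?_ hs
  · rw [← isBigO_norm_left]
    simp only [Complex.norm_real, isBigO_norm_left]
    exact isBigO_expQuot_atTop _ (oddQuot_exponent_pos ha) _
  · rw [← isBigO_norm_left]
    simp only [Complex.norm_real, isBigO_norm_left]
    simp only [neg_neg, rpow_one]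
    exact isBigO_expQuot_zero (oddQuot_sum_coeff a) (oddQuot_sum_coeff_mul a)

lemma mellin_oddQuot_zero (ha : a ∈ Ioo 0 1) :
    mellin (fun x ↦ (oddQuot a x : ℂ)) 0 = ((log (Gamma a) - log (Gamma (1 - a)) : ℝ) : ℂ) := by
  have h := integral_inv_mul_expQuot (oddQuot_exponent_pos ha) (oddQuot_sum_coeff a)
    (oddQuot_sum_coeff_mul a)
  simp only [Fin.sum_univ_four, Matrix.cons_val, Gamma_one, Gamma_two, log_one] at h
  have h' : ∫ x in Ioi (0 : ℝ), x⁻¹ * oddQuot a x = log (Gamma a) - log (Gamma (1 - a)) := by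
    rw [oddQuot, h]; ring
  rw [← h', ← integral_complex_ofReal, mellin]
  simp [Complex.cpow_neg_one]

lemma mellin_oddQuot_of_one_lt_re (ha : a ∈ Ioo 0 1) {s : ℂ} (hs : 1 < s.re) :
    mellin (fun x ↦ (oddQuot a x : ℂ)) s =
      Complex.Gamma s * (2 * HurwitzZeta.hurwitzZetaOdd a s - (1 - 2 * a)) := by
  have ha' : 0 < 1 - a := sub_pos.2 ha.2
  have hG : Complex.Gamma s = mellin (fun x : ℝ ↦ (exp (-x) : ℂ)) s := by
    rw [Complex.Gamma_eq_integral (by linarith), Complex.GammaIntegral_eq_mellin]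
  have hGc : MellinConvergent (fun x : ℝ ↦ (exp (-x) : ℂ)) s := by
    have := Complex.GammaIntegral_convergent (s := s) (by linarith)
    refine this.congr_fun (fun x _ ↦ ?_) measurableSet_Ioi
    simp [mul_comm]
  have h1 := mellinConvergent_exp_div ha.1 hs
  have h2 := mellinConvergent_exp_div ha' hs
  have hsplit : mellin (fun x ↦ (oddQuot a x : ℂ)) s =
      mellin (fun x : ℝ ↦ ((exp (-(a * x)) / (1 - exp (-x)) : ℝ) : ℂ)) s -
      mellin (fun x : ℝ ↦ ((exp (-((1 - a) * x)) / (1 - exp (-x)) : ℝ) : ℂ)) s -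
      (1 - 2 * a) * Complex.Gamma s := by
    rw [hG, ← (hasMellin_sub h1 h2).2, ← smul_eq_mul, ← mellin_const_smul,
      ← (hasMellin_sub (hasMellin_sub h1 h2).1 (hGc.const_smul _)).2]
    refine setIntegral_congr_fun measurableSet_Ioi fun x hx ↦ ?_
    simp only [oddQuot_eq a hx]
    push_cast
    simp
  have hsum := (hasSum_mellin_exp_div ha.1 hs).sub (hasSum_mellin_exp_div ha' hs)
  have hodd := (HurwitzZeta.hasSum_nat_hurwitzZetaOdd_of_mem_Icc (Ioo_subset_Icc_self ha)
    hs).mul_left (2 * Complex.Gamma s)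
  have heq := hsum.unique (hodd.congr_fun fun n ↦ by push_cast; ring_nf)
  rw [hsplit, heq]; ring

/-- Both sides are analytic on Re s > -1 and agree on Re s > 1. Subtracting the multiple of exp (-x)
is what lets the Mellin transform reach s = 0. -/
lemma two_mul_hurwitzZetaOdd_eq (ha : a ∈ Ioo 0 1) {s : ℂ} (hs : -1 < s.re) :
    2 * HurwitzZeta.hurwitzZetaOdd a s =
      (1 - 2 * a) + (Complex.Gamma s)⁻¹ * mellin (fun x ↦ (oddQuot a x : ℂ)) s := by
  have hU : IsOpen {s : ℂ | -1 < s.re} := isOpen_lt continuous_const Complex.continuous_re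
  have hL : AnalyticOnNhd ℂ (fun s ↦ 2 * HurwitzZeta.hurwitzZetaOdd a s) {s : ℂ | -1 < s.re} :=
    ((HurwitzZeta.differentiable_hurwitzZetaOdd a).const_mul 2).differentiableOn.analyticOnNhd hU
  have hR : AnalyticOnNhd ℂ (fun s ↦ (1 - 2 * a) +
      (Complex.Gamma s)⁻¹ * mellin (fun x ↦ (oddQuot a x : ℂ)) s) {s : ℂ | -1 < s.re} := by
    refine DifferentiableOn.analyticOnNhd (fun s hs ↦ ?_) hU
    exact (((Complex.differentiable_one_div_Gamma s).mul
      (differentiableAt_mellin_oddQuot ha hs)).const_add _).differentiableWithinAt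
  refine hL.eqOn_of_preconnected_of_eventuallyEq hR
    (convex_halfSpace_re_gt (-1)).isPreconnected (z₀ := 2) (by simp; norm_num) ?_ hs
  filter_upwards [(isOpen_lt continuous_const Complex.continuous_re).mem_nhds
    (show (1 : ℝ) < (2 : ℂ).re by simp)] with s (hs : 1 < s.re)
  rw [mellin_oddQuot_of_one_lt_re ha hs, inv_mul_cancel_left₀
    (Complex.Gamma_ne_zero_of_re_pos (by linarith))]
  ring

lemma hurwitzZetaOdd_apply_zero (ha : a ∈ Ioo 0 1) :
    HurwitzZeta.hurwitzZetaOdd a 0 = 1 / 2 - a := by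
  have h := two_mul_hurwitzZetaOdd_eq ha (s := 0) (by simp)
  -- The convention Γ(0) = 0 with 0⁻¹ = 0 agrees here with the entire function 1 / Γ, which vanishes
  -- at 0.
  rw [Complex.Gamma_zero] at h
  linear_combination h / 2

/-- As 1 / Γ(s) vanishes at 0 with derivative 1, only the value of the Mellin transform at 0
survives in the derivative. -/
lemma hasDerivAt_hurwitzZetaOdd_zero (ha : a ∈ Ioo 0 1) :
    HasDerivAt (HurwitzZeta.hurwitzZetaOdd a)
      ((log (Gamma a) - log (Gamma (1 - a))) / 2 : ℝ) 0 := by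
  have hG : HasDerivAt (fun s ↦ (Complex.Gamma s)⁻¹) 1 0 := by
    have h := (hasDerivAt_id (0 : ℂ)).mul
      ((Complex.differentiable_one_div_Gamma.comp (differentiable_id.add_const 1)) 0).hasDerivAt
    refine (h.congr_deriv (by simp)).congr_of_eventuallyEq (.of_forall fun s ↦ ?_)
    exact Complex.one_div_Gamma_eq_self_mul_one_div_Gamma_add_one s
  have hM := (differentiableAt_mellin_oddQuot ha (s := 0) (by simp)).hasDerivAt
  have h := ((hG.mul hM).const_add ((1 : ℂ) - 2 * a)).div_const 2
  refine (h.congr_deriv ?_).congr_of_eventuallyEq ?_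
  · simp only [Complex.Gamma_zero, mellin_oddQuot_zero ha]
    push_cast; simp
  · filter_upwards [(isOpen_lt continuous_const Complex.continuous_re).mem_nhds
      (show (-1 : ℝ) < (0 : ℂ).re by simp)] with s hs
    simp [← two_mul_hurwitzZetaOdd_eq ha hs]

/-- By the functional equation the function is ζ_odd(a, 1 - s) (2π)ˢ / (2 sin (πs / 2)). The sine is
stationary at s = 1, so only the other two factors are differentiated. -/
lemma hasDerivAt_Gamma_mul_sinZeta_one (ha : a ∈ Ioo 0 1) :
    HasDerivAt (fun s ↦ Complex.Gamma s * HurwitzZeta.sinZeta a s)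
      (π * (log (2 * π) * (1 / 2 - a) - (log (Gamma a) - log (Gamma (1 - a))) / 2) : ℝ) 1 := by
  have hpi : (2 * π : ℂ) ≠ 0 := by simp [pi_ne_zero]
  have hsin : HasDerivAt (fun s : ℂ ↦ Complex.sin (π * s / 2)) 0 1 := by
    have := (((hasDerivAt_id (1 : ℂ)).const_mul (π : ℂ)).div_const 2).csin
    refine this.congr_deriv ?_
    simp [Complex.cos_pi_div_two]
  have hodd : HasDerivAt (fun s ↦ HurwitzZeta.hurwitzZetaOdd a (1 - s))
      (-((log (Gamma a) - log (Gamma (1 - a))) / 2 : ℝ)) 1 := by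
    have h0 := hasDerivAt_hurwitzZetaOdd_zero ha
    rw [← sub_self (1 : ℂ)] at h0
    exact h0.comp_const_sub 1 1
  have hpow : HasDerivAt (fun s : ℂ ↦ (2 * π : ℂ) ^ s) ((2 * π) * Complex.log (2 * π)) 1 := by
    simpa using (hasDerivAt_id (1 : ℂ)).const_cpow (.inl hpi)
  have h := (hodd.mul hpow).div (hsin.const_mul 2) (by simp [Complex.sin_pi_div_two])
  refine (h.congr_deriv ?_).congr_of_eventuallyEq ?_
  · have hlog : Complex.log (2 * π) = (log (2 * π) : ℝ) := by
      rw [Complex.ofReal_log (by positivity)]; push_cast; rfl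
    simp only [sub_self, hurwitzZetaOdd_apply_zero ha, hlog, mul_one, Complex.sin_pi_div_two,
      Complex.cpow_one]
    push_cast
    ring
  · have hne : ∀ᶠ s : ℂ in 𝓝 1, Complex.sin (π * s / 2) ≠ 0 :=
      hsin.continuousAt.eventually_ne (by simp [Complex.sin_pi_div_two])
    filter_upwards [hne, (isOpen_lt continuous_const Complex.continuous_re).mem_nhds
      (show (0 : ℝ) < (1 : ℂ).re by simp)] with s hs hs0
    have hs' (n : ℕ) : s ≠ -n := by
      rintro rfl
      simp only [Complex.neg_re, Complex.natCast_re, Left.neg_pos_iff] at hs0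
      exact absurd hs0 (not_lt.2 n.cast_nonneg)
    have hc : (2 * π : ℂ) ^ s ≠ 0 := by simp [Complex.cpow_eq_zero_iff, hpi]
    simp only [Pi.mul_apply, Pi.div_apply, HurwitzZeta.hurwitzZetaOdd_one_sub _ hs', Complex.cpow_neg]
    field_simp

end HurwitzOdd

/-! ### Logarithmic integrals as derivatives of Mellin transforms at s = 1. -/

section LogMellin

variable {g : ℝ → ℝ}

lemma isBigO_ofReal_comp_atTop_rpow (hg : g =O[atTop] fun x ↦ exp (-x)) (r : ℝ) :
    (fun x ↦ (g x : ℂ)) =O[atTop] fun x : ℝ ↦ x ^ r := by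
  rw [← isBigO_norm_left]
  simp only [Complex.norm_real, isBigO_norm_left]
  exact hg.trans (by simpa using isBigO_exp_neg_mul_atTop one_pos r)

lemma isBigO_ofReal_comp_zero (hc : Continuous g) :
    (fun x ↦ (g x : ℂ)) =O[𝓝[>] 0] fun x : ℝ ↦ x ^ (-0 : ℝ) := by
  simpa using (((Complex.continuous_ofReal.comp hc).tendsto 0).mono_left
    nhdsWithin_le_nhds).isBigO_one ℝ

lemma mellin_hasDerivAt_ofReal (hc : Continuous g) (hg : g =O[atTop] fun x ↦ exp (-x)) {s : ℂ}
    (hs : 0 < s.re) :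
    MellinConvergent (fun x ↦ log x • (g x : ℂ)) s ∧
      HasDerivAt (mellin fun x ↦ (g x : ℂ)) (mellin (fun x ↦ log x • (g x : ℂ)) s) s :=
  mellin_hasDerivAt_of_isBigO_rpow (a := s.re + 1)
    ((Complex.continuous_ofReal.comp hc).locallyIntegrable.locallyIntegrableOn _)
    (isBigO_ofReal_comp_atTop_rpow hg _) (by linarith) (isBigO_ofReal_comp_zero hc) hs

lemma integrableOn_log_mul (hc : Continuous g) (hg : g =O[atTop] fun x ↦ exp (-x)) :
    IntegrableOn (fun x ↦ log x * g x) (Ioi 0) := by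
  have h := (mellin_hasDerivAt_ofReal hc hg (s := 1) (by simp)).1
  have h' : IntegrableOn (fun x ↦ ((log x * g x : ℝ) : ℂ)) (Ioi 0) := by
    simpa [MellinConvergent] using! h
  simpa using! h'.re

lemma mellin_hasDerivAt_one (hc : Continuous g) (hg : g =O[atTop] fun x ↦ exp (-x)) :
    HasDerivAt (mellin fun x ↦ (g x : ℂ)) (∫ x in Ioi (0 : ℝ), log x * g x : ℝ) 1 := by
  refine (mellin_hasDerivAt_ofReal hc hg (s := 1) (by simp)).2.congr_deriv ?_
  rw [← integral_complex_ofReal, mellin]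
  simp

end LogMellin

lemma isBigO_div_cosh_sub {h : ℝ → ℝ} (hh : h =O[atTop] fun _ ↦ (1 : ℝ)) (b : ℝ) :
    (fun x ↦ h x / (cosh x - b)) =O[atTop] fun x ↦ exp (-x) := by
  have h1 : (fun x ↦ (cosh x - b)⁻¹) =O[atTop] fun x ↦ exp (-x) := by
    refine IsBigO.of_bound 4 ?_
    filter_upwards [tendsto_exp_atTop.eventually_ge_atTop (4 * |b|),
      eventually_ge_atTop (1 : ℝ)] with x hx hx1
    have hb := le_abs_self b
    have he := exp_pos x
    have hlow : exp x / 4 ≤ cosh x - b := by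
      rw [cosh_eq]; linarith [exp_pos (-x)]
    rw [norm_inv, norm_of_nonneg (by linarith), norm_of_nonneg (exp_pos _).le, exp_neg,
      ← div_eq_mul_inv, inv_le_comm₀ (by linarith) (by positivity), inv_div]
    exact hlow
  simpa [div_eq_mul_inv] using! hh.mul h1

/-! ### Malmsten's integrals. -/

section Malmsten

variable {a : ℝ}

lemma cos_two_pi_mul_lt_one (ha : a ∈ Ioo 0 1) : cos (2 * π * a) < 1 := by
  refine lt_of_le_of_ne (cos_le_one _) fun h ↦ ?_
  have := (cos_eq_one_iff_of_lt_of_lt (x := 2 * π * a) (by nlinarith [pi_pos, ha.1])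
    (by nlinarith [pi_pos, ha.2])).1 h
  exact (mul_pos two_pi_pos ha.1).ne' this

/-- Imaginary part of the geometric series with ratio exp (-x + iθ). -/
lemma hasSum_sin_mul_exp (θ : ℝ) {x : ℝ} (hx : 0 < x) :
    HasSum (fun n : ℕ ↦ sin (θ * n) * exp (-n * x)) (sin θ / 2 / (cosh x - cos θ)) := by
  set z : ℂ := Complex.exp (-x + θ * Complex.I) with hz
  have hnorm : ‖z‖ < 1 := by simp [hz, Complex.norm_exp, hx]
  have h := Complex.hasSum_im (hasSum_geometric_of_norm_lt_one hnorm)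
  have hre : z.re = exp (-x) * cos θ := by simp [hz, Complex.exp_re]
  have him : z.im = exp (-x) * sin θ := by simp [hz, Complex.exp_im]
  have hlt : 0 < cosh x - cos θ := by linarith [one_lt_cosh.2 hx.ne', cos_le_one θ]
  convert h.congr_fun fun n ↦ ?_ using 1
  · rw [Complex.inv_im, Complex.normSq_apply]
    simp only [Complex.sub_im, Complex.sub_re, Complex.one_im, Complex.one_re, hre, him]
    have hden : (1 - exp (-x) * cos θ) * (1 - exp (-x) * cos θ) +
        (0 - exp (-x) * sin θ) * (0 - exp (-x) * sin θ) =
        2 * exp (-x) * (cosh x - cos θ) := by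
      have h1 : exp x * exp (-x) = 1 := by rw [← exp_add]; simp
      rw [cosh_eq]
      linear_combination exp (-x) ^ 2 * sin_sq_add_cos_sq θ - h1
    rw [hden]
    have := exp_pos (-x)
    field_simp
    ring
  · rw [hz, ← Complex.exp_nat_mul, Complex.exp_im]
    simp [mul_comm]

lemma isBigO_malmsten (θ : ℝ) :
    (fun x ↦ sin θ / 2 / (cosh x - cos θ)) =O[atTop] fun x ↦ exp (-x) :=
  isBigO_div_cosh_sub (isBigO_const_const _ one_ne_zero _) _

lemma continuous_malmsten (ha : a ∈ Ioo 0 1) :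
    Continuous fun x ↦ sin (2 * π * a) / 2 / (cosh x - cos (2 * π * a)) :=
  continuous_const.div (by fun_prop) fun x ↦
    (sub_pos.2 ((cos_two_pi_mul_lt_one ha).trans_le (one_le_cosh x))).ne'

/-- Termwise integration is absolutely justified for Re s > 1; the identity theorem carries the
equality to a neighbourhood of s = 1, where it is differentiated. -/
lemma mellin_malmsten (ha : a ∈ Ioo 0 1) {s : ℂ} (hs : 0 < s.re) :
    mellin (fun x ↦ ((sin (2 * π * a) / 2 / (cosh x - cos (2 * π * a)) : ℝ) : ℂ)) s =
      Complex.Gamma s * HurwitzZeta.sinZeta a s := by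
  have hU : IsOpen {s : ℂ | 0 < s.re} := isOpen_lt continuous_const Complex.continuous_re
  have hL : AnalyticOnNhd ℂ (mellin fun x ↦
      ((sin (2 * π * a) / 2 / (cosh x - cos (2 * π * a)) : ℝ) : ℂ)) {s : ℂ | 0 < s.re} :=
    DifferentiableOn.analyticOnNhd (fun s hs ↦ (mellin_hasDerivAt_ofReal
      (continuous_malmsten ha) (isBigO_malmsten _) hs).2.differentiableAt.differentiableWithinAt) hU
  have hR : AnalyticOnNhd ℂ (fun s ↦ Complex.Gamma s * HurwitzZeta.sinZeta a s)
      {s : ℂ | 0 < s.re} := by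
    refine DifferentiableOn.analyticOnNhd (fun s (hs : 0 < s.re) ↦ ?_) hU
    refine ((Complex.differentiableAt_Gamma s fun m hm ↦ ?_).mul
      (HurwitzZeta.differentiableAt_sinZeta a s)).differentiableWithinAt
    rw [hm] at hs
    simp only [Complex.neg_re, Complex.natCast_re, Left.neg_pos_iff] at hs
    exact absurd hs (not_lt.2 m.cast_nonneg)
  refine hL.eqOn_of_preconnected_of_eventuallyEq hR
    (convex_halfSpace_re_gt 0).isPreconnected (z₀ := 2) (by simp) ?_ hs
  filter_upwards [(isOpen_lt continuous_const Complex.continuous_re).mem_nhds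
    (show (1 : ℝ) < (2 : ℂ).re by simp)] with s (hs : 1 < s.re)
  have hsum := hasSum_mellin (a := fun n : ℕ ↦ (sin (2 * π * a * n) : ℂ)) (p := fun n ↦ n)
    (F := fun x ↦ ((sin (2 * π * a) / 2 / (cosh x - cos (2 * π * a)) : ℝ) : ℂ)) (s := s)
    (fun n ↦ ?_) (by linarith) (fun x hx ↦ ?_) ?_
  · refine hsum.unique (((HurwitzZeta.hasSum_nat_sinZeta a hs).mul_left
      (Complex.Gamma s)).congr_fun fun n ↦ ?_)
    simp [mul_div_assoc]
  · rcases n.eq_zero_or_pos with rfl | hn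
    · simp
    · exact .inr (by exact_mod_cast hn)
  · exact_mod_cast Complex.hasSum_ofReal.2 (hasSum_sin_mul_exp (2 * π * a) hx)
  · refine (Real.summable_one_div_nat_rpow.2 hs).of_nonneg_of_le (fun n ↦ by positivity)
      fun n ↦ ?_
    gcongr
    rw [Complex.norm_real]
    exact abs_sin_le_one _

lemma integral_log_malmsten (ha : a ∈ Ioo 0 1) :
    ∫ x in Ioi (0 : ℝ), log x * (sin (2 * π * a) / 2 / (cosh x - cos (2 * π * a))) =
      π * (log (2 * π) * (1 / 2 - a) - (log (Gamma a) - log (Gamma (1 - a))) / 2) := by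
  have h1 := mellin_hasDerivAt_one (continuous_malmsten ha) (isBigO_malmsten (2 * π * a))
  have h2 := (hasDerivAt_Gamma_mul_sinZeta_one ha).congr_of_eventuallyEq
    (f₁ := mellin fun x ↦ ((sin (2 * π * a) / 2 / (cosh x - cos (2 * π * a)) : ℝ) : ℂ)) (by
      filter_upwards [(isOpen_lt continuous_const Complex.continuous_re).mem_nhds
        (show (0 : ℝ) < (1 : ℂ).re by simp)] with s hs using mellin_malmsten ha hs)
  exact_mod_cast h1.unique h2

end Malmsten

/-! ### Decay at infinity and the integration by parts. -/

section Decay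

variable {c : ℝ}

lemma isBigO_cosh_exp : cosh =O[atTop] exp := by
  refine IsBigO.of_bound 1 ?_
  filter_upwards [eventually_ge_atTop 0] with x hx
  rw [norm_of_nonneg (cosh_pos x).le, norm_of_nonneg (exp_pos x).le, cosh_eq]
  linarith [exp_le_exp.2 (neg_le_self hx)]

lemma isBigO_sinh_exp : sinh =O[atTop] exp := by
  refine (IsBigO.of_bound 1 (.of_forall fun x ↦ ?_)).trans isBigO_cosh_exp
  rw [norm_eq_abs, norm_of_nonneg (cosh_pos x).le, abs_le, one_mul, sinh_eq, cosh_eq]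
  constructor <;> linarith [exp_pos x, exp_pos (-x)]

lemma isBigO_inv_add_cosh_two_mul (c : ℝ) :
    (fun x ↦ (c + cosh (2 * x))⁻¹) =O[atTop] fun x ↦ exp (-(2 * x)) := by
  have h := (isBigO_div_cosh_sub (isBigO_refl (fun _ ↦ (1 : ℝ)) _) (-c)).comp_tendsto
    (tendsto_id.const_mul_atTop (zero_lt_two' ℝ))
  refine h.congr (fun x ↦ ?_) fun x ↦ rfl
  simp [add_comm]

lemma isBigO_div_add_cosh_two_mul {h : ℝ → ℝ} (hh : h =O[atTop] exp) (c : ℝ) :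
    (fun x ↦ h x / (c + cosh (2 * x))) =O[atTop] fun x ↦ exp (-x) := by
  refine (hh.mul (isBigO_inv_add_cosh_two_mul c)).congr (fun x ↦ (div_eq_mul_inv _ _).symm)
    fun x ↦ ?_
  rw [← exp_add]; ring_nf

lemma isBigO_sinh_mul_sinh_div (c : ℝ) :
    (fun x ↦ sinh x * sinh (2 * x) / (c + cosh (2 * x)) ^ 2) =O[atTop] fun x ↦ exp (-x) := by
  have h2 : (fun x ↦ sinh (2 * x)) =O[atTop] fun x ↦ exp (2 * x) :=
    isBigO_sinh_exp.comp_tendsto (tendsto_id.const_mul_atTop (zero_lt_two' ℝ))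
  refine ((isBigO_div_add_cosh_two_mul isBigO_sinh_exp c).mul
    (h2.mul (isBigO_inv_add_cosh_two_mul c))).congr (fun x ↦ ?_) fun x ↦ ?_
  · rw [div_eq_mul_inv, div_eq_mul_inv, ← inv_pow]; ring
  · simp [← exp_add]

lemma add_cosh_pos (hc : -1 < c) (x : ℝ) : 0 < c + cosh (2 * x) := by
  linarith [one_le_cosh (2 * x)]

lemma continuous_div_add_cosh {h : ℝ → ℝ} (hh : Continuous h) (hc : -1 < c) :
    Continuous fun x ↦ h x / (c + cosh (2 * x)) :=
  hh.div (by fun_prop) fun x ↦ (add_cosh_pos hc x).ne'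

lemma integrableOn_log_mul_sinh_mul_sinh_div (hc : -1 < c) :
    IntegrableOn (fun x ↦ log x * (sinh x * sinh (2 * x) / (c + cosh (2 * x)) ^ 2)) (Ioi 0) :=
  integrableOn_log_mul (Continuous.div (by fun_prop) (by fun_prop)
    fun x ↦ (pow_pos (add_cosh_pos hc x) 2).ne') (isBigO_sinh_mul_sinh_div c)

lemma integrableOn_log_mul_cosh_div (hc : -1 < c) :
    IntegrableOn (fun x ↦ log x * (cosh x / (c + cosh (2 * x)))) (Ioi 0) :=
  integrableOn_log_mul (continuous_div_add_cosh continuous_cosh hc)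
    (isBigO_div_add_cosh_two_mul isBigO_cosh_exp c)

lemma integral_log_mul_sinh_mul_sinh_div (hc : -1 < c)
    (hK : IntegrableOn (fun x ↦ x⁻¹ * (sinh x / (c + cosh (2 * x)))) (Ioi 0)) :
    ∫ x in Ioi (0 : ℝ), log x * (sinh x * sinh (2 * x) / (c + cosh (2 * x)) ^ 2) =
      ((∫ x in Ioi (0 : ℝ), log x * (cosh x / (c + cosh (2 * x)))) +
        ∫ x in Ioi (0 : ℝ), x⁻¹ * (sinh x / (c + cosh (2 * x)))) / 2 := by
  have hJ := integrableOn_log_mul_cosh_div hc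
  have hI := integrableOn_log_mul_sinh_mul_sinh_div hc
  have hv (x : ℝ) : HasDerivAt (fun x ↦ sinh x / (c + cosh (2 * x)))
      (cosh x / (c + cosh (2 * x)) - 2 * (sinh x * sinh (2 * x) / (c + cosh (2 * x)) ^ 2)) x := by
    have hq := (add_cosh_pos hc x).ne'
    have h := (hasDerivAt_sinh x).div
      ((((hasDerivAt_id x).const_mul 2).cosh).const_add c) hq
    refine h.congr_deriv ?_
    simp only [id]
    field_simp
  have hfun (x : ℝ) : log x *
      (cosh x / (c + cosh (2 * x)) - 2 * (sinh x * sinh (2 * x) / (c + cosh (2 * x)) ^ 2)) =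
      log x * (cosh x / (c + cosh (2 * x))) -
        2 * (log x * (sinh x * sinh (2 * x) / (c + cosh (2 * x)) ^ 2)) := by ring
  have hint : IntegrableOn (fun x ↦ log x * (cosh x / (c + cosh (2 * x)) -
      2 * (sinh x * sinh (2 * x) / (c + cosh (2 * x)) ^ 2))) (Ioi 0) := by
    simp_rw [hfun]
    exact hJ.sub (hI.const_mul 2)
  -- The linear vanishing of sinh at 0 absorbs the logarithm.
  have hzero : Tendsto (log * fun x ↦ sinh x / (c + cosh (2 * x))) (𝓝[>] 0) (𝓝 0) := by
    have h1 : (fun x ↦ sinh x / (c + cosh (2 * x))) =O[𝓝[>] 0] fun x ↦ x := by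
      simpa using (hv 0).differentiableAt.isBigO_sub.mono nhdsWithin_le_nhds
    refine ((isBigO_refl log _).mul h1).trans_tendsto ?_
    simpa using tendsto_log_mul_rpow_nhdsGT_zero one_pos
  have hinfty : Tendsto (log * fun x ↦ sinh x / (c + cosh (2 * x))) atTop (𝓝 0) := by
    have h1 : (fun x ↦ sinh x / (c + cosh (2 * x))) =O[atTop] fun x : ℝ ↦ x ^ (-1 : ℝ) :=
      (isBigO_div_add_cosh_two_mul isBigO_sinh_exp c).trans
        (by simpa using isBigO_exp_neg_mul_atTop one_pos (-1))
    have h2 := isLittleO_log_id_atTop.mul_isBigO h1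
    refine (isLittleO_one_iff ℝ).1 (h2.trans_isBigO ?_)
    refine IsBigO.of_bound 1 ?_
    filter_upwards [eventually_gt_atTop 0] with x hx
    simp [rpow_neg_one, hx.ne']
  have h := integral_Ioi_deriv_mul_eq_sub (fun x hx ↦ hasDerivAt_log (ne_of_gt hx))
    (fun x _ ↦ hv x) (hK.add hint) hzero hinfty
  rw [integral_add hK hint] at h
  simp_rw [hfun] at h
  rw [integral_sub hJ (hI.const_mul 2), integral_const_mul] at h
  linarith

end Decay

/-! ### The integral J by partial fractions. -/

section LogCosh

lemma integral_log_mul_cosh_div {b : ℝ} (hb : b ∈ Ioo 0 (1 / 4)) :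
    ∫ x in Ioi (0 : ℝ), log x * (cosh x / (cos (4 * π * b) + cosh (2 * x))) =
      π / (4 * cos (2 * π * b)) *
        (log (2 * π) + log (Gamma (3 / 4 - b)) + log (Gamma (3 / 4 + b)) -
          log (Gamma (1 / 4 + b)) - log (Gamma (1 / 4 - b))) := by
  have ha1 : 1 / 4 + b ∈ Ioo (0 : ℝ) 1 := ⟨by linarith [hb.1], by linarith [hb.2]⟩
  have ha2 : 1 / 4 - b ∈ Ioo (0 : ℝ) 1 := ⟨by linarith [hb.2], by linarith [hb.1]⟩
  have hcos : 0 < cos (2 * π * b) :=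
    cos_pos_of_mem_Ioo ⟨by nlinarith [pi_pos, hb.1], by nlinarith [pi_pos, hb.2]⟩
  have hs1 : sin (2 * π * (1 / 4 + b)) = cos (2 * π * b) := by
    rw [show 2 * π * (1 / 4 + b) = 2 * π * b + π / 2 by ring, sin_add_pi_div_two]
  have hs2 : sin (2 * π * (1 / 4 - b)) = cos (2 * π * b) := by
    rw [show 2 * π * (1 / 4 - b) = π / 2 - 2 * π * b by ring, sin_pi_div_two_sub]
  have hc1 : cos (2 * π * (1 / 4 + b)) = -sin (2 * π * b) := by
    rw [show 2 * π * (1 / 4 + b) = 2 * π * b + π / 2 by ring, cos_add_pi_div_two]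
  have hc2 : cos (2 * π * (1 / 4 - b)) = sin (2 * π * b) := by
    rw [show 2 * π * (1 / 4 - b) = π / 2 - 2 * π * b by ring, cos_pi_div_two_sub]
  have hi1 := integrableOn_log_mul (continuous_malmsten ha1) (isBigO_malmsten _)
  have hi2 := integrableOn_log_mul (continuous_malmsten ha2) (isBigO_malmsten _)
  have hsplit (x : ℝ) : log x * (cosh x / (cos (4 * π * b) + cosh (2 * x))) =
      (2 * cos (2 * π * b))⁻¹ *
      (log x * (sin (2 * π * (1 / 4 + b)) / 2 / (cosh x - cos (2 * π * (1 / 4 + b)))) +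
        log x * (sin (2 * π * (1 / 4 - b)) / 2 / (cosh x - cos (2 * π * (1 / 4 - b))))) := by
    have h1 := cos_two_pi_mul_lt_one ha1
    have h2 := cos_two_pi_mul_lt_one ha2
    rw [hs1, hs2, hc1, hc2]
    rw [hc1] at h1
    rw [hc2] at h2
    have h3 : 0 < cosh x - -sin (2 * π * b) := by linarith [one_le_cosh x]
    have h4 : 0 < cosh x - sin (2 * π * b) := by linarith [one_le_cosh x]
    -- The denominator is 2 (cosh² x - sin² (2πb)); its two factors are Malmsten denominators at a =
    -- 1/4 ± b, with common sine cos (2πb).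
    have hden : cos (4 * π * b) + cosh (2 * x) =
        2 * ((cosh x - -sin (2 * π * b)) * (cosh x - sin (2 * π * b))) := by
      rw [show 4 * π * b = 2 * (2 * π * b) by ring, cos_two_mul, cosh_two_mul]
      linear_combination 2 * sin_sq_add_cos_sq (2 * π * b) - cosh_sq x
    rw [hden]
    field_simp
    ring
  simp_rw [hsplit]
  rw [integral_const_mul, integral_add hi1 hi2, integral_log_malmsten ha1,
    integral_log_malmsten ha2, show 1 - (1 / 4 + b) = 3 / 4 - b by ring,
    show 1 - (1 / 4 - b) = 3 / 4 + b by ring]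
  field_simp
  ring

end LogCosh

/-! ### The integral K as a finite combination of log Γ. -/

section SinhQuot

variable {ι : Type*} [Fintype ι] {γ : ι → ℝ} {r : ι → ℕ} {P : ℕ} {c : ℝ}

lemma sinh_div_add_cosh_eq_expQuot (hc : -1 < c) (hP : 0 < P)
    (h : ∀ q : ℝ, (q - q ^ 3) * (1 - q ^ P) = (∑ i, γ i * q ^ r i) * (1 + 2 * c * q ^ 2 + q ^ 4))
    {x : ℝ} (hx : 0 < x) :
    sinh x / (c + cosh (2 * x)) = expQuot γ (fun i ↦ r i / P) (P * x) := by
  have hP' : (0 : ℝ) < P := by exact_mod_cast hP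
  have hq := exp_pos (-x)
  have h1 : 0 < 1 - exp (-(P * x)) := one_sub_exp_neg_pos (by positivity)
  have hpow (n : ℕ) : exp (-(n * x)) = exp (-x) ^ n := by rw [← exp_nat_mul]; ring_nf
  have hsum : ∑ i, γ i * exp (-(r i / P * (P * x))) = ∑ i, γ i * exp (-x) ^ r i := by
    refine Finset.sum_congr rfl fun i _ ↦ ?_
    rw [← hpow]; field_simp
  have hsinh : sinh x * (2 * exp (-x)) = 1 - exp (-x) ^ 2 := by
    have : exp x * exp (-x) = 1 := by rw [← exp_add]; simp
    rw [sinh_eq]; linear_combination this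
  have hcosh : (c + cosh (2 * x)) * (2 * exp (-x) ^ 2) =
      1 + 2 * c * exp (-x) ^ 2 + exp (-x) ^ 4 := by
    have h1 : exp (2 * x) * exp (-x) ^ 2 = 1 := by
      rw [← exp_nat_mul, ← exp_add]; simp
    have h2 : exp (-(2 * x)) = exp (-x) ^ 2 := by exact_mod_cast hpow 2
    rw [cosh_eq, h2]; linear_combination h1
  rw [expQuot, hsum, div_eq_div_iff (add_cosh_pos hc x).ne' h1.ne', hpow]
  have hx' := h (exp (-x))
  rw [← hcosh] at hx'
  have h2 : 2 * exp (-x) ^ 2 ≠ 0 := by positivity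
  refine mul_right_cancel₀ h2 ?_
  linear_combination hx' + exp (-x) * (1 - exp (-x) ^ P) * hsinh

/-- Because dx / x is scale invariant, replacing x by P x reduces the denominator 1 - q ^ P to the
one in `expQuot`. -/
lemma integral_inv_mul_sinh_div (hc : -1 < c) (hP : 0 < P)
    (h : ∀ q : ℝ, (q - q ^ 3) * (1 - q ^ P) = (∑ i, γ i * q ^ r i) * (1 + 2 * c * q ^ 2 + q ^ 4))
    (hr : ∀ i, 0 < r i) (h0 : ∑ i, γ i = 0) (h1 : ∑ i, γ i * r i = 0) :
    IntegrableOn (fun x ↦ x⁻¹ * (sinh x / (c + cosh (2 * x)))) (Ioi 0) ∧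
      ∫ x in Ioi (0 : ℝ), x⁻¹ * (sinh x / (c + cosh (2 * x))) =
        ∑ i, γ i * log (Gamma (r i / P)) := by
  have hP' : (0 : ℝ) < P := by exact_mod_cast hP
  have hα (i : ι) : (0 : ℝ) < r i / P := div_pos (by exact_mod_cast hr i) hP'
  have h1' : ∑ i, γ i * ((r i : ℝ) / P) = 0 := by
    simp_rw [← mul_div_assoc, ← Finset.sum_div, h1, zero_div]
  have heq : EqOn (fun x : ℝ ↦ P * ((P * x)⁻¹ * expQuot γ (fun i ↦ r i / P) (P * x)))
      (fun x ↦ x⁻¹ * (sinh x / (c + cosh (2 * x)))) (Ioi 0) := fun x (hx : 0 < x) ↦ by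
    simp only [sinh_div_add_cosh_eq_expQuot hc hP h hx]
    field_simp
  have hint := integrableOn_inv_mul_expQuot hα h0 h1'
  constructor
  · refine IntegrableOn.congr_fun ?_ heq measurableSet_Ioi
    exact ((integrableOn_Ioi_comp_mul_left_iff
      (fun x ↦ x⁻¹ * expQuot γ (fun i ↦ r i / P) x) 0 hP').2 (by simpa using hint)).const_mul _
  · rw [← setIntegral_congr_fun measurableSet_Ioi heq, integral_const_mul,
      integral_comp_mul_left_Ioi (fun x ↦ x⁻¹ * expQuot γ (fun i ↦ r i / P) x) 0 hP',
      mul_zero, integral_inv_mul_expQuot hα h0 h1', smul_eq_mul, mul_inv_cancel_left₀ hP'.ne']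

end SinhQuot

/-! ### The general evaluation and tools for simplifying its values. -/

lemma logSinhIntegrand_eq (t x : ℝ) : logSinhIntegrand t x =
    log x * (sinh x * sinh (2 * x) / (cos t + cosh (2 * x)) ^ 2) := by
  rw [logSinhIntegrand]; ring

lemma neg_one_lt_cos {t : ℝ} (ht : t ∈ Ioo 0 π) : -1 < cos t := by
  rw [← cos_pi]
  exact cos_lt_cos_of_nonneg_of_le_pi ht.1.le le_rfl ht.2

lemma integrableOn_logSinhIntegrand {t : ℝ} (ht : t ∈ Ioo 0 π) :
    IntegrableOn (fun x ↦ logSinhIntegrand t x) (Ioi 0) := by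
  simp_rw [logSinhIntegrand_eq]
  exact integrableOn_log_mul_sinh_mul_sinh_div (neg_one_lt_cos ht)

/-- If `sinh x / (cos t + cosh 2x)` is a quotient of a polynomial in `q = exp (-x)` by `1 - q ^ P`,
then the integral of `logSinhIntegrand t` is a combination of values of `log Γ`. -/
theorem integral_logSinhIntegrand {ι : Type*} [Fintype ι] {γ : ι → ℝ} {r : ι → ℕ} {P : ℕ}
    {t b : ℝ} (hb : b ∈ Ioo 0 (1 / 4)) (ht : t = 4 * π * b) (hP : 0 < P)
    (h : ∀ q : ℝ,
      (q - q ^ 3) * (1 - q ^ P) = (∑ i, γ i * q ^ r i) * (1 + 2 * cos t * q ^ 2 + q ^ 4))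
    (hr : ∀ i, 0 < r i) (h0 : ∑ i, γ i = 0) (h1 : ∑ i, γ i * r i = 0) :
    ∫ x in Ioi (0 : ℝ), logSinhIntegrand t x =
      π / (8 * cos (2 * π * b)) *
        (log (2 * π) + log (Gamma (3 / 4 - b)) + log (Gamma (3 / 4 + b)) -
          log (Gamma (1 / 4 + b)) - log (Gamma (1 / 4 - b))) +
      (∑ i, γ i * log (Gamma (r i / P))) / 2 := by
  have hc : -1 < cos t := neg_one_lt_cos
    ⟨by have := hb.1; rw [ht]; positivity, by rw [ht]; nlinarith [pi_pos, hb.2]⟩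
  obtain ⟨hK, hK'⟩ := integral_inv_mul_sinh_div hc hP h hr h0 h1
  simp_rw [logSinhIntegrand_eq]
  rw [integral_log_mul_sinh_mul_sinh_div hc hK, hK', ht, integral_log_mul_cosh_div hb]
  ring

lemma log_Gamma_add_log_Gamma_one_sub {s : ℝ} (hs : s ∈ Ioo 0 1) :
    log (Gamma s) + log (Gamma (1 - s)) = log π - log (sin (π * s)) := by
  have hsin : 0 < sin (π * s) := sin_pos_of_pos_of_lt_pi (by nlinarith [pi_pos, hs.1])
    (by nlinarith [pi_pos, hs.2])
  rw [← log_mul (Gamma_pos_of_pos hs.1).ne' (Gamma_pos_of_pos (sub_pos.2 hs.2)).ne',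
    Real.Gamma_mul_Gamma_one_sub, log_div pi_ne_zero hsin.ne']

lemma log_cos_sub_log_sin {x : ℝ} (hx : x ∈ Ioo 0 (π / 2)) :
    log (cos x) - log (sin x) = log ((1 + cos (2 * x)) / sin (2 * x)) := by
  have hc : 0 < cos x := cos_pos_of_mem_Ioo ⟨by linarith [hx.1, pi_pos], hx.2⟩
  have hs : 0 < sin x := sin_pos_of_pos_of_lt_pi hx.1 (by linarith [hx.2, pi_pos])
  rw [← log_div hc.ne' hs.ne', cos_two_mul, sin_two_mul]
  congr 1
  field_simp
  ring

lemma log_two_pi_mul_Gamma_div {w x y z : ℝ} (hw : 0 < w) (hx : 0 < x) (hy : 0 < y)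
    (hz : 0 < z) :
    log (2 * π * Gamma w * Gamma x / (Gamma y * Gamma z)) =
      log (2 * π) + log (Gamma w) + log (Gamma x) - log (Gamma y) - log (Gamma z) := by
  have hw' := (Gamma_pos_of_pos hw).ne'
  have hx' := (Gamma_pos_of_pos hx).ne'
  have hy' := (Gamma_pos_of_pos hy).ne'
  have hz' := (Gamma_pos_of_pos hz).ne'
  have hp := two_pi_pos.ne'
  rw [log_div (by positivity) (by positivity), log_mul (by positivity) hx', log_mul hp hw',
    log_mul hy' hz']
  ring

lemma arcoth_sqrt_three : arcoth √3 = log (2 + √3) / 2 := by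
  have h3 : √3 * √3 = 3 := mul_self_sqrt (by norm_num)
  have h1 : 1 < √3 := by rw [lt_sqrt] <;> norm_num
  have hquot : (1 + (√3)⁻¹) / (1 - (√3)⁻¹) = 2 + √3 := by
    have h4 : √3 - 1 ≠ 0 := (sub_pos.2 h1).ne'
    have h5 : 1 - (√3)⁻¹ = (√3 - 1) / √3 := by field_simp
    rw [h5]
    field_simp
    linear_combination -h3
  rw [arcoth, artanh_eq_half_log ⟨by linarith [inv_pos.2 (zero_lt_one.trans h1)],
    (inv_lt_one_of_one_lt₀ h1).le⟩, hquot]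
  ring

/-! ### The four special values. -/

lemma integral_logSinhIntegrand_pi_div_two :
    ∫ x in Ioi (0 : ℝ), logSinhIntegrand (π / 2) x =
      1 / 8 * (4 * arsinh 1 + √2 * π *
        log (2 * π * Gamma (5 / 8) * Gamma (7 / 8) / (Gamma (1 / 8) * Gamma (3 / 8)))) := by
  -- 1 + q⁴ divides 1 - q⁸, leaving the numerator (q - q³)(1 - q⁴).
  have h := integral_logSinhIntegrand (γ := ![1, -1, -1, 1]) (r := ![1, 3, 5, 7]) (P := 8)
    (t := π / 2) (b := 1 / 8) (by norm_num) (by ring) (by norm_num)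
    (fun q ↦ by simp only [Fin.sum_univ_four, Matrix.cons_val, cos_pi_div_two]; ring)
    (fun i ↦ by fin_cases i <;> simp)
    (by simp [Fin.sum_univ_four])
    (by simp [Fin.sum_univ_four]; norm_num)
  have h1 := log_Gamma_add_log_Gamma_one_sub (s := 1 / 8) (by norm_num)
  have h3 := log_Gamma_add_log_Gamma_one_sub (s := 3 / 8) (by norm_num)
  have hs : sin (π * (3 / 8)) = cos (π * (1 / 8)) := by
    rw [← cos_pi_div_two_sub]; ring_nf
  have hcot := log_cos_sub_log_sin (x := π * (1 / 8))
    ⟨by positivity, by linarith [pi_pos]⟩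
  rw [show 2 * (π * (1 / 8)) = π / 4 by ring, cos_pi_div_four, sin_pi_div_four] at hcot
  have hq : (1 + √2 / 2) / (√2 / 2) = 1 + √(1 + 1 ^ 2) := by
    have h2 : √2 * √2 = 2 := mul_self_sqrt (by norm_num)
    rw [show (1 : ℝ) + 1 ^ 2 = 2 by norm_num]
    field_simp
    linear_combination -h2
  rw [hq] at hcot
  rw [h, log_two_pi_mul_Gamma_div (by norm_num) (by norm_num) (by norm_num) (by norm_num), arsinh,
    ← hcot, show 2 * π * (1 / 8) = π / 4 by ring, cos_pi_div_four]
  simp only [Fin.sum_univ_four, Matrix.cons_val]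
  norm_num at h1 h3 hs ⊢
  have h2 : π / (8 * (√2 / 2)) = √2 * π / 8 := by
    have h2 : √2 * √2 = 2 := mul_self_sqrt (by norm_num)
    field_simp
    linear_combination -h2
  rw [h2]
  rw [hs] at h3
  -- Reflection pairs 1/8 with 7/8 and 3/8 with 5/8, leaving log cot (π/8) = log (1 + √2) = arsinh
  -- 1.
  linear_combination (h1 - h3) / 2

lemma integral_logSinhIntegrand_pi_div_three :
    ∫ x in Ioi (0 : ℝ), logSinhIntegrand (π / 3) x =
      4 * (1 / 288 * (10 * √3 * π * log 2 + 6 * log 64 + 9 * √3 * π * log π +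
        6 * √3 * π * log (Gamma (5 / 6) / Gamma (1 / 6) ^ 2))) := by
  -- 1 + q² + q⁴ = (1 - q⁶) / (1 - q²), leaving (q - q³)(1 - q²).
  have h := integral_logSinhIntegrand (γ := ![1, -2, 1]) (r := ![1, 3, 5]) (P := 6)
    (t := π / 3) (b := 1 / 12) (by norm_num) (by ring) (by norm_num)
    (fun q ↦ by simp only [Fin.sum_univ_three, Matrix.cons_val, cos_pi_div_three]; ring)
    (fun i ↦ by fin_cases i <;> simp)
    (by simp [Fin.sum_univ_three]; norm_num)
    (by simp [Fin.sum_univ_three]; norm_num)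
  have h1 := log_Gamma_add_log_Gamma_one_sub (s := 1 / 6) (by norm_num)
  rw [show π * (1 / 6) = π / 6 by ring, sin_pi_div_six, log_div one_ne_zero two_ne_zero,
    log_one] at h1
  have hpos {s : ℝ} (hs : 0 < s) : Gamma s ≠ 0 := (Gamma_pos_of_pos hs).ne'
  -- Duplication at 1/6 eliminates Γ(2/3) / Γ(1/3), which comes from J, in favour of Γ(1/6).
  have hdup := congrArg log (Real.Gamma_mul_Gamma_add_half (1 / 6))
  rw [log_mul (hpos (by norm_num)) (hpos (by norm_num)), log_mul (by
      have := hpos (s := 2 * (1 / 6)) (by norm_num)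
      positivity) (by positivity), log_mul (hpos (by norm_num)) (by positivity),
    log_rpow two_pos, log_sqrt pi_pos.le] at hdup
  have h64 : log 64 = 6 * log 2 := by
    rw [show (64 : ℝ) = 2 ^ 6 by norm_num, log_pow]; norm_num
  rw [h, log_div (hpos (by norm_num)) (pow_ne_zero _ (hpos (by norm_num))), log_pow, h64,
    show 2 * π * (1 / 12) = π / 6 by ring, cos_pi_div_six, log_mul two_ne_zero pi_ne_zero]
  simp only [Fin.sum_univ_three, Matrix.cons_val]
  have hhalf : log (Gamma ((3 : ℕ) / (6 : ℕ))) = log π / 2 := by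
    rw [show (((3 : ℕ) : ℝ) / (6 : ℕ)) = 1 / 2 by norm_num, Gamma_one_half_eq, log_sqrt pi_pos.le]
  rw [hhalf]
  norm_num at h1 hdup ⊢
  have h2 : π / (8 * (√3 / 2)) = √3 * π / 12 := by
    have h3 : √3 * √3 = 3 := mul_self_sqrt (by norm_num)
    field_simp
    linear_combination -8 * h3
  rw [h2]
  linear_combination h1 / 2 + √3 * π / 12 * hdup

lemma integral_logSinhIntegrand_pi_div_four :
    ∫ x in Ioi (0 : ℝ), logSinhIntegrand (π / 4) x =
      1 / 2 * ((1 + √2) * log (tan (3 * π / 16)) - log (tan (π / 16))) +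
        π / (8 * cos (π / 8)) * log (2 * π * Gamma (11 / 16) * Gamma (13 / 16) /
          (Gamma (3 / 16) * Gamma (5 / 16))) := by
  have h2 : √2 ^ 2 = 2 := sq_sqrt (by norm_num)
  -- (1 + √2 q² + q⁴)(1 - √2 q² + q⁴) = 1 + q⁸ divides 1 - q¹⁶, leaving (q - q³)(1 - √2 q² + q⁴)(1 -
  -- q⁸).
  have h := integral_logSinhIntegrand
    (γ := ![1, -(1 + √2), 1 + √2, -1, -1, 1 + √2, -(1 + √2), 1])
    (r := ![1, 3, 5, 7, 9, 11, 13, 15]) (P := 16)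
    (t := π / 4) (b := 1 / 16) (by norm_num) (by ring) (by norm_num)
    (fun q ↦ by
      simp only [Fin.sum_univ_eight, Matrix.cons_val, cos_pi_div_four]
      linear_combination (q ^ 5 - q ^ 7 - q ^ 13 + q ^ 15) * h2)
    (fun i ↦ by fin_cases i <;> simp)
    (by simp [Fin.sum_univ_eight])
    (by simp [Fin.sum_univ_eight]; ring)
  have h1 := log_Gamma_add_log_Gamma_one_sub (s := 1 / 16) (by norm_num)
  have h3 := log_Gamma_add_log_Gamma_one_sub (s := 3 / 16) (by norm_num)
  have h5 := log_Gamma_add_log_Gamma_one_sub (s := 5 / 16) (by norm_num)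
  have h7 := log_Gamma_add_log_Gamma_one_sub (s := 7 / 16) (by norm_num)
  have hs5 : sin (π * (5 / 16)) = cos (π * (3 / 16)) := by
    rw [← cos_pi_div_two_sub]; ring_nf
  have hs7 : sin (π * (7 / 16)) = cos (π * (1 / 16)) := by
    rw [← cos_pi_div_two_sub]; ring_nf
  have htan {x : ℝ} (hx : x ∈ Ioo 0 (π / 2)) : log (tan x) = log (sin x) - log (cos x) := by
    rw [tan_eq_sin_div_cos, log_div
      (sin_pos_of_pos_of_lt_pi hx.1 (by linarith [hx.2, pi_pos])).ne'
      (cos_pos_of_mem_Ioo ⟨by linarith [hx.1, pi_pos], hx.2⟩).ne']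
  have ht1 := htan (x := π * (1 / 16)) ⟨by positivity, by linarith [pi_pos]⟩
  have ht3 := htan (x := π * (3 / 16)) ⟨by positivity, by linarith [pi_pos]⟩
  rw [h, log_two_pi_mul_Gamma_div (by norm_num) (by norm_num) (by norm_num) (by norm_num),
    show 3 * π / 16 = π * (3 / 16) by ring, show π / 16 = π * (1 / 16) by ring, ht1, ht3,
    show 2 * π * (1 / 16) = π / 8 by ring]
  simp only [Fin.sum_univ_eight, Matrix.cons_val]
  rw [hs5] at h5
  rw [hs7] at h7
  norm_num at h1 h3 h5 h7 ⊢
  linear_combination (h1 - h7 + (1 + √2) * (h5 - h3)) / 2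

lemma integral_logSinhIntegrand_two_pi_div_three :
    ∫ x in Ioi (0 : ℝ), logSinhIntegrand (2 * π / 3) x =
      4 * (1 / 16 * (4 * arcoth √3 + π *
        log (2 * π * Gamma (7 / 12) * Gamma (11 / 12) / (Gamma (1 / 12) * Gamma (5 / 12))))) := by
  have hcos : cos (2 * π / 3) = -(1 / 2) := by
    rw [show 2 * π / 3 = π - π / 3 by ring, cos_pi_sub, cos_pi_div_three]
  -- 1 - q² + q⁴ = (1 + q⁶) / (1 + q²), leaving (q - q⁵)(1 - q⁶).
  have h := integral_logSinhIntegrand (γ := ![1, -1, -1, 1]) (r := ![1, 5, 7, 11]) (P := 12)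
    (t := 2 * π / 3) (b := 1 / 6) (by norm_num) (by ring) (by norm_num)
    (fun q ↦ by simp only [Fin.sum_univ_four, Matrix.cons_val, hcos]; ring)
    (fun i ↦ by fin_cases i <;> simp)
    (by simp [Fin.sum_univ_four])
    (by simp [Fin.sum_univ_four]; norm_num)
  have h1 := log_Gamma_add_log_Gamma_one_sub (s := 1 / 12) (by norm_num)
  have h5 := log_Gamma_add_log_Gamma_one_sub (s := 5 / 12) (by norm_num)
  have hs : sin (π * (5 / 12)) = cos (π * (1 / 12)) := by
    rw [← cos_pi_div_two_sub]; ring_nf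
  have hcot := log_cos_sub_log_sin (x := π * (1 / 12))
    ⟨by positivity, by linarith [pi_pos]⟩
  rw [show 2 * (π * (1 / 12)) = π / 6 by ring, cos_pi_div_six, sin_pi_div_six,
    show (1 + √3 / 2) / (1 / 2) = 2 + √3 by ring] at hcot
  rw [h, log_two_pi_mul_Gamma_div (by norm_num) (by norm_num) (by norm_num) (by norm_num),
    arcoth_sqrt_three, ← hcot, show 2 * π * (1 / 6) = π / 3 by ring, cos_pi_div_three]
  simp only [Fin.sum_univ_four, Matrix.cons_val]
  rw [hs] at h5
  norm_num at h1 h5 ⊢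
  -- After reflection K is log cot (π/12) = log (2 + √3), twice `arcoth √3`.
  linear_combination (h1 - h5) / 2

/-- Closed forms of the integrals of `log x · sinh x · sinh 2x / (cos t + cosh 2x)²` over `(0, ∞)`
for `t = π/2, π/3, π/4, 2π/3`, together with the convergence of these integrals. The values for
`t = π/2`, `π/3`, `2π/3` are given for the rewritten integrands, in which `cos t` is evaluated and
the denominator cleared. -/
theorem mainTheorem9 :
    -- absolute convergence
    (∀ t ∈ ({Real.pi / 2, Real.pi / 3, Real.pi / 4, 2 * Real.pi / 3} : Set ℝ),
      MeasureTheory.IntegrableOn (fun x : ℝ => logSinhIntegrand t x) (Set.Ioi 0)) ∧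
    -- the case t = π/2
    ((∀ x : ℝ, logSinhIntegrand (Real.pi / 2) x =
        Real.log x * Real.sinh x * Real.tanh (2 * x) * (1 / Real.cosh (2 * x))) ∧
      ∫ x in Set.Ioi (0 : ℝ),
          Real.log x * Real.sinh x * Real.tanh (2 * x) * (1 / Real.cosh (2 * x)) =
        1 / 8 * (4 * Real.arsinh 1 + √2 * Real.pi *
          Real.log (2 * Real.pi * Real.Gamma (5 / 8) * Real.Gamma (7 / 8) /
            (Real.Gamma (1 / 8) * Real.Gamma (3 / 8))))) ∧
    -- the case t = π/3
    ((∀ x : ℝ, logSinhIntegrand (Real.pi / 3) x =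
        4 * (Real.log x * Real.sinh x * Real.sinh (2 * x) / (2 * Real.cosh (2 * x) + 1) ^ 2)) ∧
      ∫ x in Set.Ioi (0 : ℝ),
          Real.log x * Real.sinh x * Real.sinh (2 * x) / (2 * Real.cosh (2 * x) + 1) ^ 2 =
        1 / 288 * (10 * √3 * Real.pi * Real.log 2 + 6 * Real.log 64 +
          9 * √3 * Real.pi * Real.log Real.pi +
          6 * √3 * Real.pi * Real.log (Real.Gamma (5 / 6) / Real.Gamma (1 / 6) ^ 2))) ∧
    -- the case t = π/4
    (∫ x in Set.Ioi (0 : ℝ), logSinhIntegrand (Real.pi / 4) x =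
        1 / 2 * ((1 + √2) * Real.log (Real.tan (3 * Real.pi / 16)) -
            Real.log (Real.tan (Real.pi / 16))) +
          Real.pi / (8 * Real.cos (Real.pi / 8)) *
            Real.log (2 * Real.pi * Real.Gamma (11 / 16) * Real.Gamma (13 / 16) /
              (Real.Gamma (3 / 16) * Real.Gamma (5 / 16)))) ∧
    -- the case t = 2π/3
    ((∀ x : ℝ, logSinhIntegrand (2 * Real.pi / 3) x =
        4 * (Real.log x * Real.sinh x * Real.sinh (2 * x) / (2 * Real.cosh (2 * x) - 1) ^ 2)) ∧
      ∫ x in Set.Ioi (0 : ℝ),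
          Real.log x * Real.sinh x * Real.sinh (2 * x) / (2 * Real.cosh (2 * x) - 1) ^ 2 =
        1 / 16 * (4 * arcoth √3 + Real.pi *
          Real.log (2 * Real.pi * Real.Gamma (7 / 12) * Real.Gamma (11 / 12) /
            (Real.Gamma (1 / 12) * Real.Gamma (5 / 12))))) := by
  have h2 (x : ℝ) : logSinhIntegrand (π / 2) x =
      log x * sinh x * tanh (2 * x) * (1 / cosh (2 * x)) := by
    have := (cosh_pos (2 * x)).ne'
    rw [logSinhIntegrand, cos_pi_div_two, tanh_eq_sinh_div_cosh]
    field_simp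
    ring
  have h3 (x : ℝ) : logSinhIntegrand (π / 3) x =
      4 * (log x * sinh x * sinh (2 * x) / (2 * cosh (2 * x) + 1) ^ 2) := by
    rw [logSinhIntegrand, cos_pi_div_three,
      show 2 * cosh (2 * x) + 1 = 2 * (1 / 2 + cosh (2 * x)) by ring, mul_pow]
    have : 0 < 1 / 2 + cosh (2 * x) := by linarith [cosh_pos (2 * x)]
    field_simp
    ring
  have h23 (x : ℝ) : logSinhIntegrand (2 * π / 3) x =
      4 * (log x * sinh x * sinh (2 * x) / (2 * cosh (2 * x) - 1) ^ 2) := by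
    rw [logSinhIntegrand, show 2 * π / 3 = π - π / 3 by ring, cos_pi_sub, cos_pi_div_three,
      show 2 * cosh (2 * x) - 1 = 2 * (-(1 / 2) + cosh (2 * x)) by ring, mul_pow]
    have : 0 < -(1 / 2) + cosh (2 * x) := by linarith [one_le_cosh (2 * x)]
    field_simp
    ring
  refine ⟨fun t ht ↦ integrableOn_logSinhIntegrand ?_, ⟨h2, ?_⟩, ⟨h3, ?_⟩,
    integral_logSinhIntegrand_pi_div_four, ⟨h23, ?_⟩⟩
  · have := pi_pos
    rcases ht with rfl | rfl | rfl | rfl <;> constructor <;> linarith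
  · simp_rw [← h2]
    exact integral_logSinhIntegrand_pi_div_two
  · have h := integral_logSinhIntegrand_pi_div_three
    simp_rw [h3] at h
    rw [integral_const_mul] at h
    exact mul_left_cancel₀ four_ne_zero h
  · have h := integral_logSinhIntegrand_two_pi_div_three
    simp_rw [h23] at h
    rw [integral_const_mul] at h
    exact mul_left_cancel₀ four_ne_zero h
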